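/- Let $(\mathcal Z,\mathcal A)$ be a measurable space and $\mathcal H$ a separable reproducing kernel Hilbert space of functions $\mathcal Z\to\mathbb R$ whose kernel $k$ is measurable and bounded, $|k(x,y)|\le K$ for all $x,y\in\mathcal Z$. Let $P\ll Q$ be probability measures on $\mathcal Z$ such that $\frac{dP}{dQ}-1$ coincides $Q$-almost everywhere with an element of $\mathcal H$. Write $\mu_P=\mathbb E_{X\sim P}[k(X,\cdot)]$ and $\mu_Q=\mathbb E_{Y\sim Q}[k(Y,\cdot)]$ for the kernel mean embeddings and $\Sigma_Q=\mathbb E_{Y\sim Q}[k(Y,\cdot)\otimes k(Y,\cdot)]$ for the uncentered covariance operator on $\mathcal H$. Let $\theta\in(1,2]$ and assume $\mu_P-\mu_Q\in\mathrm{Ran}(\Sigma_Q^\theta)$, say $\mu_P-\mu_Q=\Sigma_Q^\theta w$ with $w\in\mathcal H$, $\|w\|_{\mathcal H}\le R$. For points $\mathbf X=(X_1,\dots,X_m)$, $\mathbf Y=(Y_1,\dots,Y_n)$ of $\mathcal Z$ and $\lambda>0$ define, for $u\in\mathcal Z$, $$\widehat r_\lambda(u)=\frac{1}{m\lambda}k_{u\mathbf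 X}\mathbf 1_m-\frac{1}{n\lambda}k_{u\mathbf Y}\mathbf 1_n-\frac{1}{m\lambda}k_{u\mathbf Y}L_{\mathbf Y\mathbf Y,\lambda}^{-1}k_{\mathbf Y\mathbf X}\mathbf 1_m+\frac{1}{n\lambda}k_{u\mathbf Y}L_{\mathbf Y\mathbf Y,\lambda}^{-1}k_{\mathbf Y\mathbf Y}\mathbf 1_n+1,$$ where $\mathbf 1_m,\mathbf 1_n$ are all-ones vectors, $k_{u\mathbf X}=(k(u,X_i))_i$ and $k_{u\mathbf Y}=(k(u,Y_j))_j$ are row vectors, $k_{\mathbf Y\mathbf X}=(k(Y_j,X_i))_{j,i}$, $k_{\mathbf Y\mathbf Y}=(k(Y_i,Y_j))_{i,j}$ and $L_{\mathbf Y\mathbf Y,\lambda}=n\lambda I+k_{\mathbf Y\mathbf Y}$. (Equivalently, $\widehat r_\lambda=1+(\Sigma_{\widehat Q}+\lambda I)^{-1}(\mu_{\widehat P}-\mu_{\widehat Q})$ with $\widehat P,\widehat Q$ the empirical measures of $\mathbf X,\mathbf Y$.) There is a constant $\mathsf C_1>0$ depending only on $K$ and $R$ (in particular, not on $m$, $n$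 or $\eta$) and, for all $\mathcal Z,\mathcal H,P,Q,\theta,w$ as above, a version $r$ of the Radon--Nikodym derivative $\frac{dP}{dQ}$, not depending on the samples, $m$, $n$ or $\eta$, such that the following holds. For all $m,n\ge1$ and $\eta\in(0,e^{-1})$, if $X_1,\dots,X_m$ are i.i.d. from $P$ and $Y_1,\dots,Y_n$ are i.i.d. from $Q$, then with $N=\min(m,n)$ and $\lambda=N^{-1/(2(\theta+1))}$, with probability at least $1-\eta$, the function $\widehat r_\lambda-r$ belongs to $\mathcal H$ and $$\big\|\widehat r_\lambda-r\big\|_{\mathcal H}\le \mathsf C_1\,N^{-\frac{\theta-1}{2(\theta+1)}}\sqrt{\ln(1/\eta)}.$$ -/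

import Mathlib

open MeasureTheory ProbabilityTheory Matrix
open scoped ENNReal

universe u v t

noncomputable section

namespace WitnessConvergence

section RKHSObjects

variable {Z : Type*} (H : Type*) [NormedAddCommGroup H] [InnerProductSpace ℝ H]
  [CompleteSpace H] [RKHS ℝ H Z ℝ]

/-- The canonical feature map `z ↦ k(z, ·)` of a real-valued RKHS. -/
def featureMap (z : Z) : H := RKHS.kerFun H z 1

/-- The real-valued reproducing kernel `k(x, y)` of `H`. -/
def realKernel (x y : Z) : ℝ := RKHS.kernel H x y 1

/-- The RKHS norm of a function `f : Z → ℝ`, with value `∞` if `f` is not an element of `H`. -/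
def rkhsNorm (f : Z → ℝ) : ℝ≥0∞ := ⨅ (g : H) (_ : (g : Z → ℝ) = f), ‖g‖ₑ

variable [MeasurableSpace Z]

/-- The kernel mean embedding `μ_P = E_P[k(X, ·)]`. -/
def meanEmbedding (P : Measure Z) : H := ∫ z, featureMap H z ∂P

/-- The (uncentered) covariance operator `Σ_Q = E_Q[k(Y, ·) ⊗ k(Y, ·)]`. -/
def covarianceOp (Q : Measure Z) : H →L[ℝ] H :=
  ∫ z, InnerProductSpace.rankOne ℝ (featureMap H z) (featureMap H z) ∂Q

end RKHSObjects

/-- The fractional power `T ^ θ`, `θ > 0`, of a positive compact operator `T` on a real Hilbert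
space, through its spectral decomposition: `T ^ θ w = ∑_σ σ ^ θ Π_σ w`, where `Π_σ` is the
orthogonal projection onto the eigenspace `ker (T - σ)` (which is zero unless `σ` is one of the
countably many eigenvalues). -/
def fractionalPower {H : Type*} [NormedAddCommGroup H] [InnerProductSpace ℝ H] [CompleteSpace H]
    (T : H →L[ℝ] H) (θ : ℝ) (w : H) : H :=
  ∑' σ : ℝ, σ ^ θ • (Module.End.eigenspace (T : H →ₗ[ℝ] H) σ).starProjection w

section Estimator

variable {Z : Type*} (k : Z → Z → ℝ)

/-- The matrix `k_{xy} = (k (x i) (y j))`. -/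
def kernelMatrix {m n : ℕ} (x : Fin m → Z) (y : Fin n → Z) : Matrix (Fin m) (Fin n) ℝ :=
  Matrix.of fun i j => k (x i) (y j)

/-- The row vector `k_{ux} = (k u (x i))`. -/
def kernelRow {m : ℕ} (u : Z) (x : Fin m → Z) : Fin m → ℝ := fun i => k u (x i)

/-- The regularized matrix `L_{yy,lam} = n lam I + k_{yy}`. -/
def regularizedGram {n : ℕ} (lam : ℝ) (y : Fin n → Z) : Matrix (Fin n) (Fin n) ℝ :=
  ((n : ℝ) * lam) • (1 : Matrix (Fin n) (Fin n) ℝ) + kernelMatrix k y y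

/-- The kernel estimator of the likelihood ratio `dP/dQ` from samples `x` of `P` and `y` of `Q`. -/
def ratioEstimator (lam : ℝ) {m n : ℕ} (x : Fin m → Z) (y : Fin n → Z) (u : Z) : ℝ :=
  1 / (m * lam) * (kernelRow k u x ⬝ᵥ 1)
    - 1 / (n * lam) * (kernelRow k u y ⬝ᵥ 1)
    - 1 / (m * lam) *
        (kernelRow k u y ⬝ᵥ ((regularizedGram k lam y)⁻¹ *ᵥ (kernelMatrix k y x *ᵥ 1)))
    + 1 / (n * lam) *
        (kernelRow k u y ⬝ᵥ ((regularizedGram k lam y)⁻¹ *ᵥ (kernelMatrix k y y *ᵥ 1)))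
    + 1

end Estimator

section BasicFacts

open scoped InnerProductSpace

variable {Z : Type*} {H : Type*} [NormedAddCommGroup H] [InnerProductSpace ℝ H]
  [CompleteSpace H] [RKHS ℝ H Z ℝ]

theorem featureMap_apply (x u : Z) : featureMap H x u = realKernel H u x := by
  simp [featureMap, realKernel, RKHS.kerFun_apply]

theorem inner_featureMap (f : H) (z : Z) : ⟪f, featureMap H z⟫_ℝ = f z := by
  simp [featureMap]

theorem realKernel_eq (x y : Z) : realKernel H x y = ⟪featureMap H x, featureMap H y⟫_ℝ := by
  rw [real_inner_comm, inner_featureMap (featureMap H y) x, featureMap_apply]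

theorem coe_sum {ι : Type*} (s : Finset ι) (f : ι → H) (u : Z) :
    (∑ i ∈ s, f i) u = ∑ i ∈ s, f i u := by
  simp [← inner_featureMap, sum_inner]

/-- The estimator is `1 + h` with `h = (Σ̂_Q + lam)⁻¹ (μ̂_P - μ̂_Q)`, where `Σ̂_Q`, `μ̂_P`, `μ̂_Q` are the
empirical covariance operator and mean embeddings. -/
theorem ratioEstimator_eq {lam : ℝ} (hl : 0 < lam) {m n : ℕ} (hn : 0 < n)
    (x : Fin m → Z) (y : Fin n → Z) :
    ∃ h : H, (∀ u, ratioEstimator (realKernel H) lam x y u = 1 + h u) ∧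
      (n : ℝ)⁻¹ • ∑ j, h (y j) • featureMap H (y j) + lam • h =
        (m : ℝ)⁻¹ • ∑ i, featureMap H (x i) - (n : ℝ)⁻¹ • ∑ j, featureMap H (y j) := by
  set v : Fin n → ℝ := (1 / (m * lam)) • (kernelMatrix (realKernel H) y x *ᵥ 1) -
    (1 / (n * lam)) • (kernelMatrix (realKernel H) y y *ᵥ 1) with hv
  set L := regularizedGram (realKernel H) lam y with hL
  set a := L⁻¹ *ᵥ v with ha
  have hdet : IsUnit L.det := by
    have h1 : kernelMatrix (realKernel H) y y = Matrix.gram ℝ (fun j => featureMap H (y j)) := by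
      ext i j
      simp [kernelMatrix, realKernel_eq, Matrix.gram]
    have hpos : 0 < (n : ℝ) * lam := by positivity
    have h2 : L.PosDef := by
      rw [hL, regularizedGram, h1]
      exact (Matrix.PosDef.one.smul hpos).add_posSemidef (Matrix.posSemidef_gram ℝ _)
    exact (Matrix.isUnit_iff_isUnit_det L).1 h2.isUnit
  have hLa : L *ᵥ a = v := by
    rw [ha, Matrix.mulVec_mulVec, Matrix.mul_nonsing_inv _ hdet, Matrix.one_mulVec]
  set h : H := (1 / (m * lam)) • ∑ i, featureMap H (x i) - (1 / (n * lam)) • ∑ j, featureMap H (y j)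
    - ∑ j, a j • featureMap H (y j) with hh
  have hu : ∀ u, h u = 1 / (m * lam) * (kernelRow (realKernel H) u x ⬝ᵥ 1)
    - 1 / (n * lam) * (kernelRow (realKernel H) u y ⬝ᵥ 1)
    - kernelRow (realKernel H) u y ⬝ᵥ a := by
    intro u
    simp [hh, coe_sum, featureMap_apply, kernelRow, dotProduct, mul_comm]
  refine ⟨h, fun u => ?_, ?_⟩
  · rw [hu, ratioEstimator, ha, hv, Matrix.mulVec_sub, Matrix.mulVec_smul, Matrix.mulVec_smul,
      dotProduct_sub, dotProduct_smul, dotProduct_smul]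
    simp only [smul_eq_mul]
    ring
  · have key : ∀ j, h (y j) = n * lam * a j := by
      intro j
      have := congrFun hLa j
      rw [hu]
      simp only [hL, regularizedGram, Matrix.add_mulVec, Matrix.smul_mulVec, Matrix.one_mulVec,
        Pi.add_apply, Pi.smul_apply, smul_eq_mul, hv, Pi.sub_apply] at this
      simp only [Matrix.mulVec, kernelMatrix, Matrix.of_apply] at this
      have e1 : ∀ {p} (z : Fin p → Z) , kernelRow (realKernel H) (y j) z = fun i => realKernel H (y j) (z i) := fun z => rfl
      rw [e1, e1]
      linarith
    have hn' : (n : ℝ) ≠ 0 := by positivity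
    simp only [key, mul_smul, ← Finset.smul_sum]
    rw [hh]
    simp only [smul_sub, smul_smul]
    rw [inv_mul_cancel_left₀ hn']
    have : lam * (1 / (m * lam)) = (m:ℝ)⁻¹ := by
      rcases eq_or_ne (m:ℝ) 0 with h0 | h0
      · simp [h0]
      · field_simp
    have h2 : lam * (1 / (n * lam)) = (n:ℝ)⁻¹ := by field_simp
    rw [this, h2]
    abel

variable [MeasurableSpace Z]

theorem inner_meanEmbedding (P : Measure Z) (h : Integrable (featureMap H : Z → H) P) (f : H) :
    ⟪f, meanEmbedding H P⟫_ℝ = ∫ z, f z ∂P := by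
  rw [meanEmbedding, ← integral_inner h]; simp [inner_featureMap]

theorem inner_covarianceOp (Q : Measure Z)
    (h : Integrable (fun z : Z => InnerProductSpace.rankOne ℝ (featureMap H z) (featureMap H z)) Q)
    (f g : H) : ⟪f, covarianceOp H Q g⟫_ℝ = ∫ z, f z * g z ∂Q := by
  rw [covarianceOp, ContinuousLinearMap.integral_apply h, ← integral_inner (h.apply_continuousLinearMap g)]
  congr 1; ext z
  simp [InnerProductSpace.rankOne_def, inner_smul_right, inner_featureMap, real_inner_comm g]
  ring

end BasicFacts

end WitnessConvergence

end

/-! Write `T` for `Σ_Q` and `b = μ_P - μ_Q = T ^ θ w`. Both `h = dP/dQ - 1` and `g = T ^ (θ - 1) w`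
solve `T · = b`. Since `⟪f, T f⟫ = ∫ f² dQ`, elements of `ker T` vanish `Q`-a.e., so `r = 1 + g` is
a version of `dP/dQ`, independent of the samples.

The error splits at the population regularized solution `v = (T + lam)⁻¹ b`. The bias `‖v - g‖ ≤ lam
^ (θ - 1) ‖w‖` and a bound on `‖v‖` uniform in `lam` are spectral (`exists_tikhonov_of_source`).

For the stochastic part, the estimator is `1 + ĥ` with `(T̂ + lam) ĥ = μ̂_P - μ̂_Q`, whence `(T̂ +
lam)(ĥ - v)` is the deviation of `μ̂_P` from `μ_P` minus that of the empirical mean of `(1 + v(Y))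
k(Y, ·)` from its expectation `μ_Q + T v = μ_P - lam v`. Only means of bounded vectors occur, so no
operator concentration is needed: Hoeffding's inequality in Hilbert space
(`measureReal_le_norm_sum_le`) and `T̂ + lam ≥ lam` give an error of order `√(ln (1/η) / N) / lam`.
-/

namespace WitnessConvergence

/-! ### Hoeffding's inequality in Hilbert space -/

section Concentration

open scoped InnerProductSpace

/-- A hyperbolic majorant of `cosh` on the third side of a Euclidean triangle. -/
theorem cosh_le_of_sq_le {a b c τ : ℝ} (hτ : |τ| ≤ 1) (hc : c ^ 2 ≤ a ^ 2 + b ^ 2 + 2 * a * b * τ) :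
    Real.cosh c ≤ Real.cosh a * Real.cosh b + τ * (Real.sinh a * Real.sinh b) := by
  obtain ⟨h1, h2⟩ := abs_le.1 hτ
  have hR : Real.cosh a * Real.cosh b + τ * (Real.sinh a * Real.sinh b) =
      (1 + τ) / 2 * Real.cosh (a + b) + (1 - τ) / 2 * Real.cosh (a - b) := by
    rw [Real.cosh_add, Real.cosh_sub]; ring
  rw [hR]
  -- `cosh` is a power series in the square of its argument with nonnegative coefficients, and `c ^
  -- 2` is at most the average of `(a ± b) ^ 2` with weights `(1 ± τ) / 2`; convexity of `t ↦ t ^ k`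
  -- compares the series termwise.
  refine hasSum_le (fun k => ?_) (Real.hasSum_cosh c)
    (((Real.hasSum_cosh (a + b)).mul_left _).add ((Real.hasSum_cosh (a - b)).mul_left _))
  rw [mul_div_assoc', mul_div_assoc', ← add_div, pow_mul, pow_mul, pow_mul]
  refine div_le_div_of_nonneg_right ?_ (by positivity)
  calc (c ^ 2) ^ k ≤ ((1 + τ) / 2 * (a + b) ^ 2 + (1 - τ) / 2 * (a - b) ^ 2) ^ k :=
        pow_le_pow_left₀ (sq_nonneg c) (hc.trans_eq (by ring)) k
    _ ≤ _ := by
        have h : _ ≤ _ := (convexOn_pow (𝕜 := ℝ) k).2 (Set.mem_Ici.2 (sq_nonneg (a + b)))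
          (Set.mem_Ici.2 (sq_nonneg (a - b))) (by linarith : 0 ≤ (1 + τ) / 2)
          (by linarith : 0 ≤ (1 - τ) / 2) (by ring)
        simpa using h

variable {E : Type*} [NormedAddCommGroup E] [InnerProductSpace ℝ E]

/-- The correction term is linear in `y`, so it integrates to zero against an independent centred
`y`. It comes from `τ = ⟪x, y⟫ / (‖x‖ B)`. -/
theorem cosh_norm_add_le {B : ℝ} (hB : 0 < B) (x y : E) (hy : ‖y‖ ≤ B) :
    Real.cosh ‖x + y‖ ≤ Real.cosh ‖x‖ * Real.cosh B +
      ⟪(Real.sinh ‖x‖ * Real.sinh B / (‖x‖ * B)) • x, y⟫_ℝ := by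
  rcases eq_or_ne x 0 with rfl | hx
  · simpa [Real.cosh_le_cosh, abs_of_pos hB] using hy
  have hx' : 0 < ‖x‖ := norm_pos_iff.2 hx
  have hxy : |⟪x, y⟫_ℝ| ≤ ‖x‖ * B :=
    (abs_real_inner_le_norm x y).trans (by gcongr)
  have hτ : |⟪x, y⟫_ℝ / (‖x‖ * B)| ≤ 1 := by
    rw [abs_div, abs_of_pos (by positivity : 0 < ‖x‖ * B)]
    exact div_le_one_of_le₀ hxy (by positivity)
  refine (cosh_le_of_sq_le (a := ‖x‖) (b := B) hτ ?_).trans_eq ?_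
  · have h1 : 2 * ‖x‖ * B * (⟪x, y⟫_ℝ / (‖x‖ * B)) = 2 * ⟪x, y⟫_ℝ := by
      field_simp
    rw [h1, norm_add_sq_real]
    have : ‖y‖ ^ 2 ≤ B ^ 2 := by gcongr
    linarith
  · rw [real_inner_smul_left]
    ring

variable [CompleteSpace E] [MeasurableSpace E] [BorelSpace E] [SecondCountableTopology E]
  {Ω : Type*} [MeasurableSpace Ω] {Pr : Measure Ω} [IsProbabilityMeasure Pr]

theorem integrable_of_measurable_of_norm_le {F : Type*} [NormedAddCommGroup F] [MeasurableSpace F]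
    [BorelSpace F] [SecondCountableTopology F] {f : Ω → F} (hf : Measurable f) {C : ℝ}
    (hC : ∀ ω, ‖f ω‖ ≤ C) : Integrable f Pr :=
  Integrable.of_bound hf.aestronglyMeasurable C (Filter.Eventually.of_forall hC)

/-- Each new summand costs a factor `cosh B`: the linear term of `cosh_norm_add_le` pairs a function
of the earlier sum with an independent centred vector. -/
theorem integral_cosh_norm_sum_le {ι : Type*} {ξ : ι → Ω → E} (hm : ∀ i, Measurable (ξ i))
    (hind : iIndepFun ξ Pr) {B : ℝ} (hB : 0 < B) (hb : ∀ i ω, ‖ξ i ω‖ ≤ B)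
    (h0 : ∀ i, ∫ ω, ξ i ω ∂Pr = 0) (s : Finset ι) :
    ∫ ω, Real.cosh ‖∑ i ∈ s, ξ i ω‖ ∂Pr ≤ Real.cosh B ^ s.card := by
  classical
  induction s using Finset.induction_on with
  | empty => simp
  | insert a s ha ih =>
    set S : Ω → E := fun ω => ∑ i ∈ s, ξ i ω with hS
    have hSm : Measurable S := Finset.measurable_fun_sum s fun i _ => hm i
    have hSb : ∀ ω, ‖S ω‖ ≤ s.card * B := fun ω => by
      refine (norm_sum_le _ _).trans ?_
      simpa using Finset.sum_le_sum fun i (_ : i ∈ s) => hb i ω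
    set G : E → E := fun x => (Real.sinh ‖x‖ * Real.sinh B / (‖x‖ * B)) • x with hG
    have hGm : Measurable G := by
      have : Measurable Real.sinh := Real.continuous_sinh.measurable
      exact (((this.comp measurable_norm).mul_const _).div (measurable_norm.mul_const _)).smul
        measurable_id
    have hGb : ∀ ω, ‖G (S ω)‖ ≤ Real.sinh (s.card * B) * Real.sinh B / B := fun ω => by
      have hs : 0 ≤ Real.sinh B := (Real.sinh_pos_iff.2 hB).le
      have hle : Real.sinh ‖S ω‖ ≤ Real.sinh (s.card * B) := Real.sinh_le_sinh.2 (hSb ω)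
      rcases eq_or_ne (S ω) 0 with h | h
      · simp only [hG, h, smul_zero, norm_zero]
        have : 0 ≤ Real.sinh (s.card * B) := Real.sinh_nonneg_iff.2 (by positivity)
        positivity
      · have hp : 0 < ‖S ω‖ := norm_pos_iff.2 h
        have hq : 0 ≤ Real.sinh ‖S ω‖ := Real.sinh_nonneg_iff.2 hp.le
        simp only [hG, norm_smul, Real.norm_eq_abs]
        rw [abs_of_nonneg (by positivity)]
        calc Real.sinh ‖S ω‖ * Real.sinh B / (‖S ω‖ * B) * ‖S ω‖
            = Real.sinh ‖S ω‖ * Real.sinh B / B := by field_simp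
          _ ≤ _ := by gcongr
    have hindS : IndepFun (G ∘ S) (ξ a) Pr := by
      have h := hind.indepFun_finsetSum_of_notMem hm ha
      have e : (∑ j ∈ s, ξ j) = S := by ext ω; simp [hS]
      rw [e] at h
      exact h.comp hGm measurable_id
    have hξi : Integrable (ξ a) Pr := integrable_of_measurable_of_norm_le (hm a) (hb a)
    have hGi : Integrable (G ∘ S) Pr := integrable_of_measurable_of_norm_le (hGm.comp hSm) hGb
    have hzero : ∫ ω, ⟪G (S ω), ξ a ω⟫_ℝ ∂Pr = 0 := by
      refine (hindS.integral_bilin hGi hξi (innerSL ℝ)).trans ?_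
      rw [h0 a, map_zero]
    have hcosh : ∀ {f : Ω → E}, Measurable f → ∀ {C : ℝ}, (∀ ω, ‖f ω‖ ≤ C) →
        Integrable (fun ω => Real.cosh ‖f ω‖) Pr := fun {f} hf {C} hC =>
      integrable_of_measurable_of_norm_le (Real.continuous_cosh.measurable.comp hf.norm)
        (C := Real.cosh C) fun ω => by
          rw [Real.norm_eq_abs, abs_of_pos (Real.cosh_pos _), Real.cosh_le_cosh, abs_norm]
          exact (hC ω).trans (le_abs_self _)
    have hinner : Integrable (fun ω => ⟪G (S ω), ξ a ω⟫_ℝ) Pr := by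
      refine integrable_of_measurable_of_norm_le ((hGm.comp hSm).inner (hm a))
        (C := Real.sinh (s.card * B) * Real.sinh B / B * B) fun ω => ?_
      exact (norm_inner_le_norm _ _).trans
        (mul_le_mul (hGb ω) (hb a ω) (norm_nonneg _) ((norm_nonneg _).trans (hGb ω)))
    have hSa : ∀ ω, ‖S ω + ξ a ω‖ ≤ s.card * B + B := fun ω =>
      (norm_add_le _ _).trans (add_le_add (hSb ω) (hb a ω))
    have hIS := hcosh hSm hSb
    calc ∫ ω, Real.cosh ‖∑ i ∈ insert a s, ξ i ω‖ ∂Pr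
        = ∫ ω, Real.cosh ‖S ω + ξ a ω‖ ∂Pr := by
          congr 1; ext ω; rw [Finset.sum_insert ha, add_comm]
      _ ≤ ∫ ω, (Real.cosh ‖S ω‖ * Real.cosh B + ⟪G (S ω), ξ a ω⟫_ℝ) ∂Pr :=
          integral_mono (hcosh (hSm.add (hm a)) hSa) ((hIS.mul_const _).add hinner)
            fun ω => cosh_norm_add_le hB _ _ (hb a ω)
      _ = (∫ ω, Real.cosh ‖S ω‖ ∂Pr) * Real.cosh B := by
          rw [integral_add (hIS.mul_const _) hinner, hzero, add_zero, integral_mul_const]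
      _ ≤ Real.cosh B ^ (insert a s).card := by
          rw [Finset.card_insert_of_notMem ha, pow_succ]
          exact mul_le_mul_of_nonneg_right ih (Real.cosh_pos _).le

/-- Hoeffding's inequality in a Hilbert space. -/
theorem measureReal_le_norm_sum_le {n : ℕ} (hn : 0 < n) {ξ : Fin n → Ω → E}
    (hm : ∀ i, Measurable (ξ i)) (hind : iIndepFun ξ Pr) {B : ℝ} (hB : 0 < B)
    (hb : ∀ i ω, ‖ξ i ω‖ ≤ B) (h0 : ∀ i, ∫ ω, ξ i ω ∂Pr = 0) {a : ℝ} (ha : 0 < a) :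
    Pr.real {ω | a ≤ ‖∑ i, ξ i ω‖} ≤ 2 * Real.exp (-(a ^ 2 / (2 * n * B ^ 2))) := by
  have hn' : (0 : ℝ) < n := by exact_mod_cast hn
  -- This scale minimizes the Chernoff exponent `-c a + n c ^ 2 B ^ 2 / 2`.
  set c : ℝ := a / (n * B ^ 2) with hc
  have hcp : 0 < c := by positivity
  have hsum : ∀ ω, ∑ i, c • ξ i ω = c • ∑ i, ξ i ω := fun ω => (Finset.smul_sum).symm
  have hbc : ∀ i ω, ‖c • ξ i ω‖ ≤ c * B := fun i ω => by
    rw [norm_smul, Real.norm_of_nonneg hcp.le]; gcongr; exact hb i ω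
  have hmc : ∀ i, Measurable fun ω => c • ξ i ω := fun i => (hm i).const_smul c
  have hmain := integral_cosh_norm_sum_le (Pr := Pr) (ξ := fun i ω => c • ξ i ω) hmc
    (hind.comp (fun _ x => c • x) fun _ => measurable_const_smul c) (mul_pos hcp hB) hbc
    (fun i => by rw [integral_smul, h0, smul_zero]) Finset.univ
  simp only [hsum, Finset.card_univ, Fintype.card_fin, norm_smul, Real.norm_of_nonneg hcp.le]
    at hmain
  have hmeas : Measurable fun ω => Real.cosh (c * ‖∑ i, ξ i ω‖) :=
    Real.continuous_cosh.measurable.comp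
      ((Finset.measurable_fun_sum _ fun i _ => hm i).norm.const_mul c)
  have hint : Integrable (fun ω => Real.cosh (c * ‖∑ i, ξ i ω‖)) Pr := by
    refine integrable_of_measurable_of_norm_le hmeas (C := Real.cosh (c * (n * B))) fun ω => ?_
    rw [Real.norm_eq_abs, abs_of_pos (Real.cosh_pos _), Real.cosh_le_cosh,
      abs_of_nonneg (by positivity), abs_of_nonneg (by positivity)]
    gcongr
    refine (norm_sum_le _ _).trans ?_
    simpa using Finset.sum_le_sum fun i (_ : i ∈ Finset.univ) => hb i ω
  have hmarkov := mul_meas_ge_le_integral_of_nonneg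
    (Filter.Eventually.of_forall fun ω => (Real.cosh_pos _).le) hint (Real.cosh (c * a))
  have hset : {ω | Real.cosh (c * a) ≤ Real.cosh (c * ‖∑ i, ξ i ω‖)} =
      {ω | a ≤ ‖∑ i, ξ i ω‖} := by
    ext ω
    simp only [Set.mem_ofPred_eq]
    rw [Real.cosh_le_cosh, abs_of_nonneg (by positivity), abs_of_nonneg (by positivity)]
    exact mul_le_mul_iff_right₀ hcp
  rw [hset] at hmarkov
  have hpow : Real.cosh (c * B) ^ n ≤ Real.exp (a ^ 2 / (2 * n * B ^ 2)) := by
    refine (pow_le_pow_left₀ (Real.cosh_pos _).le (Real.cosh_le_exp_half_sq _) n).trans_eq ?_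
    rw [← Real.exp_nat_mul]
    congr 1
    rw [hc]
    field_simp
  have hexp : Real.exp (a ^ 2 / (n * B ^ 2)) / 2 ≤ Real.cosh (c * a) := by
    rw [Real.cosh_eq]
    have e : c * a = a ^ 2 / (n * B ^ 2) := by rw [hc]; ring
    rw [e]
    have := Real.exp_pos (-(a ^ 2 / (n * B ^ 2)))
    linarith
  have hfin : Real.exp (a ^ 2 / (n * B ^ 2)) / 2 * Pr.real {ω | a ≤ ‖∑ i, ξ i ω‖} ≤
      Real.exp (a ^ 2 / (2 * n * B ^ 2)) :=
    (mul_le_mul_of_nonneg_right hexp measureReal_nonneg).trans (hmarkov.trans (hmain.trans hpow))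
  have e2 : Real.exp (a ^ 2 / (n * B ^ 2)) =
      Real.exp (a ^ 2 / (2 * n * B ^ 2)) * Real.exp (a ^ 2 / (2 * n * B ^ 2)) := by
    rw [← Real.exp_add]; congr 1; field_simp; ring
  rw [Real.exp_neg, ← div_eq_mul_inv, le_div_iff₀ (Real.exp_pos _)]
  rw [e2] at hfin
  have := Real.exp_pos (a ^ 2 / (2 * n * B ^ 2))
  nlinarith

/-- The mean of `n` independent Hilbert-space-valued variables with norm at most `B` and common
expectation `μ` is within `5 B √(ln (1/η) / n)` of `μ`, up to probability `η / 2`. -/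
theorem measure_lt_norm_mean_sub_le {n : ℕ} (hn : 0 < n) {ξ : Fin n → Ω → E}
    (hm : ∀ i, Measurable (ξ i)) (hind : iIndepFun ξ Pr) {B : ℝ} (hB : 0 < B)
    (hb : ∀ i ω, ‖ξ i ω‖ ≤ B) {μ : E} (hμ : ∀ i, ∫ ω, ξ i ω ∂Pr = μ) {η : ℝ} (hη : 0 < η)
    (hη' : η < Real.exp (-1)) :
    Pr {ω | 5 * B * √(Real.log (1 / η) / n) < ‖(n : ℝ)⁻¹ • ∑ i, ξ i ω - μ‖} ≤
      ENNReal.ofReal (η / 2) := by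
  have hn' : (0 : ℝ) < n := by exact_mod_cast hn
  have hL : 1 < Real.log (1 / η) := by
    rw [one_div, Real.log_inv]
    have := Real.log_lt_log hη hη'
    rw [Real.log_exp] at this
    linarith
  have hηL : η = Real.exp (-Real.log (1 / η)) := by
    rw [one_div, Real.log_inv, neg_neg, Real.exp_log hη]
  set l := Real.log (1 / η)
  have hnl : 0 < √(l / n) := Real.sqrt_pos.2 (by positivity)
  have hμB : ‖μ‖ ≤ B := by
    rw [← hμ ⟨0, hn⟩]
    simpa using norm_integral_le_of_norm_le_const (μ := Pr)
      (Filter.Eventually.of_forall (hb ⟨0, hn⟩))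
  -- Centring doubles the bound, since `‖μ‖ ≤ B`.
  have key := measureReal_le_norm_sum_le (Pr := Pr) hn (ξ := fun i ω => ξ i ω - μ) (B := 2 * B)
    (fun i => (hm i).sub_const μ) (hind.comp (fun _ x => x - μ) fun _ => measurable_id.sub_const μ)
    (by positivity) (fun i ω => (norm_sub_le _ _).trans (by linarith [hb i ω]))
    (fun i => by
      rw [integral_sub (integrable_of_measurable_of_norm_le (hm i) (hb i)) (integrable_const _),
        hμ]
      simp) (a := n * (5 * B * √(l / n))) (by positivity)
  have hsq : √(l / n) ^ 2 = l / n := Real.sq_sqrt (by positivity)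
  have hexp : (n * (5 * B * √(l / n))) ^ 2 / (2 * n * (2 * B) ^ 2) = 25 / 8 * l := by
    rw [mul_pow, mul_pow, hsq]; field_simp; norm_num
  rw [hexp] at key
  -- The factor 5 makes the exponent `25 l / 8`, which is at least `l + 2` because `l > 1`; then `2
  -- e⁻² ≤ 1 / 2`.
  have hbound : 2 * Real.exp (-(25 / 8 * l)) ≤ η / 2 := by
    have h1 : Real.exp (-(25 / 8 * l)) ≤ Real.exp (-l) * Real.exp (-2) := by
      rw [← Real.exp_add]; exact Real.exp_le_exp.2 (by linarith)
    have h2 : Real.exp (-2) ≤ 1 / 4 := by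
      rw [Real.exp_neg, inv_le_comm₀ (Real.exp_pos _) (by norm_num)]
      have h3 : (2 : ℝ) ≤ Real.exp 1 := by linarith [Real.add_one_le_exp (1 : ℝ)]
      have h4 : Real.exp 2 = Real.exp 1 * Real.exp 1 := by rw [← Real.exp_add]; norm_num
      rw [h4]; norm_num; nlinarith
    rw [← hηL] at h1
    nlinarith
  have hsub : {ω | 5 * B * √(l / n) < ‖(n : ℝ)⁻¹ • ∑ i, ξ i ω - μ‖} ⊆
      {ω | n * (5 * B * √(l / n)) ≤ ‖∑ i, (ξ i ω - μ)‖} := by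
    intro ω hω
    simp only [Set.mem_ofPred_eq] at hω ⊢
    have e : ∑ i, (ξ i ω - μ) = (n : ℝ) • ((n : ℝ)⁻¹ • ∑ i, ξ i ω - μ) := by
      rw [smul_sub, smul_smul, mul_inv_cancel₀ hn'.ne', one_smul, Finset.sum_sub_distrib]
      simp [← Nat.cast_smul_eq_nsmul ℝ]
    rw [e, norm_smul, Real.norm_of_nonneg hn'.le]
    gcongr
  refine (measure_mono hsub).trans ?_
  rw [← ofReal_measureReal]
  exact ENNReal.ofReal_le_ofReal (key.trans hbound)

end Concentration

/-! ### Functions of an operator on its eigenspaces, and Tikhonov bias -/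

section SpectralCalculus

open scoped InnerProductSpace

variable {H : Type*} [NormedAddCommGroup H] [InnerProductSpace ℝ H] [CompleteSpace H]

/-- The function `f` of an operator `T` on the closed span of its eigenvectors:
`f(T) w = ∑_σ f σ Π_σ w`, with `Π_σ` the orthogonal projection onto `ker (T - σ)`. -/
noncomputable def eigenCalculus (T : H →L[ℝ] H) (f : ℝ → ℝ) (w : H) : H :=
  ∑' σ : ℝ, f σ • (Module.End.eigenspace (T : H →ₗ[ℝ] H) σ).starProjection w

variable {T : H →L[ℝ] H}

/-- Bessel's inequality: eigenspaces are orthogonal, so the sum `S` of the projections satisfies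
`‖S‖ ^ 2 = ⟪S, w⟫ ≤ ‖S‖ ‖w‖`. -/
theorem sum_eigenprojection_norm_sq_le (hT : (T : H →ₗ[ℝ] H).IsSymmetric) (w : H) (s : Finset ℝ) :
    ∑ σ ∈ s, ‖(Module.End.eigenspace (T : H →ₗ[ℝ] H) σ).starProjection w‖ ^ 2 ≤ ‖w‖ ^ 2 := by
  set V := fun σ => Module.End.eigenspace (T : H →ₗ[ℝ] H) σ
  have h1 : ‖∑ σ ∈ s, (V σ).starProjection w‖ ^ 2 = ∑ σ ∈ s, ‖(V σ).starProjection w‖ ^ 2 :=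
    hT.orthogonalFamily_eigenspaces.norm_sum
      (fun σ => ⟨(V σ).starProjection w, Submodule.starProjection_apply_mem _ w⟩) s
  have h2 : ⟪∑ σ ∈ s, (V σ).starProjection w, w⟫_ℝ = ∑ σ ∈ s, ‖(V σ).starProjection w‖ ^ 2 := by
    rw [sum_inner]
    refine Finset.sum_congr rfl fun σ _ => ?_
    rw [← real_inner_self_eq_norm_sq]
    have := (V σ).starProjection_inner_eq_zero w ((V σ).starProjection w)
      (Submodule.starProjection_apply_mem _ w)
    rw [inner_sub_left] at this
    rw [real_inner_comm]
    linarith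
  have h3 := real_inner_le_norm (∑ σ ∈ s, (V σ).starProjection w) w
  rw [h2, ← h1] at h3
  rw [← h1]
  nlinarith [norm_nonneg (∑ σ ∈ s, (V σ).starProjection w), norm_nonneg w]

/-- This is why bounds on `f` are only ever required at eigenvalues. -/
theorem eigenprojection_eq_zero {σ : ℝ} (h : Module.End.eigenspace (T : H →ₗ[ℝ] H) σ = ⊥) (w : H) :
    (Module.End.eigenspace (T : H →ₗ[ℝ] H) σ).starProjection w = 0 :=
  (Submodule.mem_bot ℝ).1 (h.le (Submodule.starProjection_apply_mem _ w))

variable {f : ℝ → ℝ} {M : ℝ}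

theorem norm_smul_eigenprojection_le
    (hf : ∀ σ, Module.End.eigenspace (T : H →ₗ[ℝ] H) σ ≠ ⊥ → |f σ| ≤ M) (w : H) (σ : ℝ) :
    ‖f σ • (Module.End.eigenspace (T : H →ₗ[ℝ] H) σ).starProjection w‖ ^ 2 ≤
      M ^ 2 * ‖(Module.End.eigenspace (T : H →ₗ[ℝ] H) σ).starProjection w‖ ^ 2 := by
  rcases eq_or_ne (Module.End.eigenspace (T : H →ₗ[ℝ] H) σ) ⊥ with h | h
  · simp [eigenprojection_eq_zero h]
  · rw [norm_smul, mul_pow]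
    gcongr
    exact hf σ h

theorem sum_smul_eigenprojection_norm_sq_le (hT : (T : H →ₗ[ℝ] H).IsSymmetric)
    (hf : ∀ σ, Module.End.eigenspace (T : H →ₗ[ℝ] H) σ ≠ ⊥ → |f σ| ≤ M) (w : H) (s : Finset ℝ) :
    ∑ σ ∈ s, ‖f σ • (Module.End.eigenspace (T : H →ₗ[ℝ] H) σ).starProjection w‖ ^ 2 ≤
      M ^ 2 * ‖w‖ ^ 2 := by
  refine (Finset.sum_le_sum fun σ _ => norm_smul_eigenprojection_le hf w σ).trans ?_
  rw [← Finset.mul_sum]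
  gcongr
  exact sum_eigenprojection_norm_sq_le hT w s

theorem summable_eigenCalculus (hT : (T : H →ₗ[ℝ] H).IsSymmetric)
    (hf : ∀ σ, Module.End.eigenspace (T : H →ₗ[ℝ] H) σ ≠ ⊥ → |f σ| ≤ M) (w : H) :
    Summable fun σ : ℝ => f σ • (Module.End.eigenspace (T : H →ₗ[ℝ] H) σ).starProjection w := by
  let l : ∀ σ, Module.End.eigenspace (T : H →ₗ[ℝ] H) σ := fun σ =>
    ⟨f σ • (Module.End.eigenspace (T : H →ₗ[ℝ] H) σ).starProjection w,
      Submodule.smul_mem _ _ (Submodule.starProjection_apply_mem _ w)⟩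
  have h : Summable fun σ => ‖l σ‖ ^ 2 :=
    summable_of_sum_le (c := M ^ 2 * ‖w‖ ^ 2) (fun _ => by positivity)
      (sum_smul_eigenprojection_norm_sq_le hT hf w)
  exact (hT.orthogonalFamily_eigenspaces.summable_iff_norm_sq_summable l).2 h

theorem norm_eigenCalculus_le (hT : (T : H →ₗ[ℝ] H).IsSymmetric) (hM : 0 ≤ M)
    (hf : ∀ σ, Module.End.eigenspace (T : H →ₗ[ℝ] H) σ ≠ ⊥ → |f σ| ≤ M) (w : H) :
    ‖eigenCalculus T f w‖ ≤ M * ‖w‖ := by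
  let l : ∀ σ, Module.End.eigenspace (T : H →ₗ[ℝ] H) σ := fun σ =>
    ⟨f σ • (Module.End.eigenspace (T : H →ₗ[ℝ] H) σ).starProjection w,
      Submodule.smul_mem _ _ (Submodule.starProjection_apply_mem _ w)⟩
  refine le_of_tendsto (summable_eigenCalculus hT hf w).hasSum.norm
    (Filter.Eventually.of_forall fun s => ?_)
  have h : ‖∑ σ ∈ s, (l σ : H)‖ ^ 2 = ∑ σ ∈ s, ‖(l σ : H)‖ ^ 2 :=
    hT.orthogonalFamily_eigenspaces.norm_sum l s
  refine abs_le_of_sq_le_sq' (h.trans_le ?_) (by positivity) |>.2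
  rw [mul_pow]
  exact sum_smul_eigenprojection_norm_sq_le hT hf w s

theorem apply_eigenCalculus (hT : (T : H →ₗ[ℝ] H).IsSymmetric)
    (hf : ∀ σ, Module.End.eigenspace (T : H →ₗ[ℝ] H) σ ≠ ⊥ → |f σ| ≤ M) (w : H) :
    T (eigenCalculus T f w) = eigenCalculus T (fun σ => σ * f σ) w := by
  rw [eigenCalculus, T.map_tsum (summable_eigenCalculus hT hf w), eigenCalculus]
  refine tsum_congr fun σ => ?_
  have := Module.End.mem_eigenspace_iff.1
    (Submodule.starProjection_apply_mem (Module.End.eigenspace (T : H →ₗ[ℝ] H) σ) w)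
  rw [map_smul, mul_comm, mul_smul]
  exact congrArg _ this

theorem eigenCalculus_smul (c : ℝ) (w : H) :
    c • eigenCalculus T f w = eigenCalculus T (fun σ => c * f σ) w := by
  simp only [eigenCalculus, mul_smul, tsum_const_smul'']

theorem eigenCalculus_add (hT : (T : H →ₗ[ℝ] H).IsSymmetric) {g : ℝ → ℝ} {M' : ℝ}
    (hf : ∀ σ, Module.End.eigenspace (T : H →ₗ[ℝ] H) σ ≠ ⊥ → |f σ| ≤ M)
    (hg : ∀ σ, Module.End.eigenspace (T : H →ₗ[ℝ] H) σ ≠ ⊥ → |g σ| ≤ M') (w : H) :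
    eigenCalculus T f w + eigenCalculus T g w = eigenCalculus T (fun σ => f σ + g σ) w := by
  simp only [eigenCalculus, add_smul]
  exact ((summable_eigenCalculus hT hf w).tsum_add (summable_eigenCalculus hT hg w)).symm

theorem eigenCalculus_congr {g : ℝ → ℝ}
    (hfg : ∀ σ, Module.End.eigenspace (T : H →ₗ[ℝ] H) σ ≠ ⊥ → f σ = g σ) (w : H) :
    eigenCalculus T f w = eigenCalculus T g w := by
  refine tsum_congr fun σ => ?_
  rcases eq_or_ne (Module.End.eigenspace (T : H →ₗ[ℝ] H) σ) ⊥ with h | h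
  · simp [eigenprojection_eq_zero h]
  · rw [hfg σ h]

/-- Source condition for Tikhonov regularization: if `b = T ^ θ w` with `1 < θ ≤ 2`, then `T g = b`
has the solution `g = T ^ (θ - 1) w`, and the regularized solutions `v = (T + lam)⁻¹ b` are bounded
and converge to `g` at rate `lam ^ (θ - 1)`. -/
theorem exists_tikhonov_of_source (hT : (T : H →ₗ[ℝ] H).IsSymmetric) {M : ℝ} (hM : 1 ≤ M)
    (hspec : ∀ σ, Module.End.eigenspace (T : H →ₗ[ℝ] H) σ ≠ ⊥ → 0 ≤ σ ∧ σ ≤ M)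
    {θ : ℝ} (h1 : 1 < θ) (h2 : θ ≤ 2) (w : H) :
    ∃ g : H, T g = fractionalPower T θ w ∧ ∀ lam : ℝ, 0 < lam →
      ∃ v : H, T v + lam • v = fractionalPower T θ w ∧ ‖v‖ ≤ M * ‖w‖ ∧
        ‖v - g‖ ≤ lam ^ (θ - 1) * ‖w‖ := by
  -- From `θ - 1 ≤ 1` and `M ≥ 1` the bound is uniform in `θ`, so the final constant does not depend
  -- on `θ`.
  have hpow : ∀ σ, Module.End.eigenspace (T : H →ₗ[ℝ] H) σ ≠ ⊥ → |σ ^ (θ - 1)| ≤ M := by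
    intro σ hσ
    obtain ⟨h0, hle⟩ := hspec σ hσ
    rw [abs_of_nonneg (Real.rpow_nonneg h0 _)]
    calc σ ^ (θ - 1) ≤ M ^ (θ - 1) := Real.rpow_le_rpow h0 hle (by linarith)
      _ ≤ M ^ (1 : ℝ) := Real.rpow_le_rpow_of_exponent_le hM (by linarith)
      _ = M := Real.rpow_one M
  have hmul : ∀ σ, Module.End.eigenspace (T : H →ₗ[ℝ] H) σ ≠ ⊥ → σ * σ ^ (θ - 1) = σ ^ θ := by
    intro σ hσ
    obtain ⟨h0, -⟩ := hspec σ hσ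
    rcases h0.eq_or_lt with h | h
    · rw [← h, zero_mul, Real.zero_rpow (by linarith)]
    · rw [← Real.rpow_one_add' h0 (by linarith)]; congr 1; ring
  refine ⟨eigenCalculus T (fun σ => σ ^ (θ - 1)) w, ?_, fun lam hl => ?_⟩
  · rw [apply_eigenCalculus hT hpow]
    exact eigenCalculus_congr hmul w
  -- The symbol is `σ ^ (θ - 1)` times `σ / (σ + lam) ≤ 1`, hence bounded uniformly in `lam`.
  have hv : ∀ σ, Module.End.eigenspace (T : H →ₗ[ℝ] H) σ ≠ ⊥ → |σ ^ θ / (σ + lam)| ≤ M := by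
    intro σ hσ
    obtain ⟨h0, -⟩ := hspec σ hσ
    have hp := hpow σ hσ
    rw [abs_of_nonneg (Real.rpow_nonneg h0 _)] at hp
    rw [← hmul σ hσ, abs_of_nonneg (by positivity), div_le_iff₀ (by positivity)]
    nlinarith [Real.rpow_nonneg h0 (θ - 1)]
  have hres : ∀ σ, Module.End.eigenspace (T : H →ₗ[ℝ] H) σ ≠ ⊥ →
      |σ ^ θ / (σ + lam) + (-1) * σ ^ (θ - 1)| ≤ lam ^ (θ - 1) := by
    intro σ hσ
    obtain ⟨h0, -⟩ := hspec σ hσ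
    have hp : 0 < σ + lam := by positivity
    have e : σ ^ θ / (σ + lam) + (-1) * σ ^ (θ - 1) = -(lam * σ ^ (θ - 1) / (σ + lam)) := by
      rw [← hmul σ hσ]; field_simp; ring
    rw [e, abs_neg, abs_of_nonneg (by positivity), div_le_iff₀ hp]
    -- Weighted AM-GM gives `σ ^ (θ - 1) lam ^ (2 - θ) ≤ σ + lam`. The weight `2 - θ` must be
    -- nonnegative: Tikhonov regularization saturates at `θ = 2`.
    have hag := Real.geom_mean_le_arith_mean2_weighted (w₁ := θ - 1) (w₂ := 2 - θ) (p₁ := σ)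
      (p₂ := lam) (by linarith) (by linarith) h0 hl.le (by ring)
    have hle : σ ^ (θ - 1) * lam ^ (2 - θ) ≤ σ + lam := by nlinarith
    have e2 : lam = lam ^ (θ - 1) * lam ^ (2 - θ) := by
      rw [← Real.rpow_add hl]; norm_num
    calc lam * σ ^ (θ - 1) = lam ^ (θ - 1) * (σ ^ (θ - 1) * lam ^ (2 - θ)) := by
          nth_rewrite 1 [e2]; ring
      _ ≤ lam ^ (θ - 1) * (σ + lam) := by gcongr
  refine ⟨eigenCalculus T (fun σ => σ ^ θ / (σ + lam)) w, ?_,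
    norm_eigenCalculus_le hT (by linarith) hv w, ?_⟩
  · have hb1 : ∀ σ, Module.End.eigenspace (T : H →ₗ[ℝ] H) σ ≠ ⊥ →
        |σ * (σ ^ θ / (σ + lam))| ≤ M * M := fun σ hσ => by
      rw [abs_mul, abs_of_nonneg (hspec σ hσ).1]
      exact mul_le_mul (hspec σ hσ).2 (hv σ hσ) (abs_nonneg _) (by linarith)
    have hb2 : ∀ σ, Module.End.eigenspace (T : H →ₗ[ℝ] H) σ ≠ ⊥ →
        |lam * (σ ^ θ / (σ + lam))| ≤ lam * M := fun σ hσ => by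
      rw [abs_mul, abs_of_pos hl]
      exact mul_le_mul_of_nonneg_left (hv σ hσ) hl.le
    rw [apply_eigenCalculus hT hv, eigenCalculus_smul, eigenCalculus_add hT hb1 hb2]
    refine eigenCalculus_congr (fun σ hσ => ?_) w
    have : 0 < σ + lam := add_pos_of_nonneg_of_pos (hspec σ hσ).1 hl
    field_simp
  · have hneg : ∀ σ, Module.End.eigenspace (T : H →ₗ[ℝ] H) σ ≠ ⊥ → |(-1) * σ ^ (θ - 1)| ≤ M :=
      fun σ hσ => by simpa using hpow σ hσ
    rw [sub_eq_add_neg, ← neg_one_smul ℝ (eigenCalculus T _ w), eigenCalculus_smul,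
      eigenCalculus_add hT hv hneg]
    exact norm_eigenCalculus_le hT (by positivity) hres w

end SpectralCalculus

/-! ### Bounds from the kernel, and countability of orthonormal sets -/

section KernelBounds

open scoped InnerProductSpace

variable {Z : Type*} {H : Type*} [NormedAddCommGroup H] [InnerProductSpace ℝ H]

/-- Distinct orthonormal vectors are `√2` apart, so balls of radius `1 / 2` are disjoint, and a
separable space holds only countably many. -/
theorem _root_.Orthonormal.countable_set [TopologicalSpace.SeparableSpace H] {s : Set H}
    (hs : Orthonormal ℝ ((↑) : s → H)) :
    s.Countable := by
  have hd : s.PairwiseDisjoint fun x => Metric.ball x (1 / 2) := by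
    intro x hx y hy hxy
    refine Metric.ball_disjoint_ball ?_
    have h0 : ⟪x, y⟫_ℝ = 0 := hs.2 (i := ⟨x, hx⟩) (j := ⟨y, hy⟩) (by simpa using hxy)
    have hx1 : ‖x‖ = 1 := hs.1 ⟨x, hx⟩
    have hy1 : ‖y‖ = 1 := hs.1 ⟨y, hy⟩
    have h2 := norm_sub_sq_real x y
    rw [h0, hx1, hy1] at h2
    rw [dist_eq_norm]
    nlinarith [norm_nonneg (x - y)]
  exact hd.countable_of_isOpen (fun _ _ => Metric.isOpen_ball)
    fun x _ => ⟨x, Metric.mem_ball_self (by norm_num)⟩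

variable [CompleteSpace H] [RKHS ℝ H Z ℝ]

theorem norm_featureMap_le {K : ℝ} (hK : ∀ x y : Z, |realKernel H x y| ≤ K) (z : Z) :
    ‖featureMap H z‖ ≤ max 1 K := by
  have h : ‖featureMap H z‖ ^ 2 ≤ K := by
    rw [← real_inner_self_eq_norm_sq, ← realKernel_eq]
    exact (le_abs_self _).trans (hK z z)
  have h1 := le_max_left 1 K
  have h2 := le_max_right 1 K
  nlinarith [norm_nonneg (featureMap H z)]

theorem abs_apply_le {M : ℝ} (hφ : ∀ z : Z, ‖featureMap H z‖ ≤ M) (f : H) (z : Z) :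
    |f z| ≤ ‖f‖ * M := by
  rw [← inner_featureMap]
  exact (abs_real_inner_le_norm _ _).trans (by gcongr; exact hφ z)

end KernelBounds

/-! ### Measurability, and the covariance operator as an `L²(Q)` form -/

section KernelMeasurability

open scoped InnerProductSpace

variable {Z : Type*} [MeasurableSpace Z] {H : Type*} [NormedAddCommGroup H]
  [InnerProductSpace ℝ H] [CompleteSpace H] [RKHS ℝ H Z ℝ]

/-- Kernel sections span a dense subspace, and norm convergence in `H` implies pointwise
convergence. -/
theorem measurable_coe (hk : ∀ x, Measurable (realKernel H (Z := Z) x)) (f : H) :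
    Measurable (f : Z → ℝ) := by
  let S : Submodule ℝ H :=
    { carrier := {f | Measurable (f : Z → ℝ)}
      add_mem' := fun {f g} hf hg => by
        simpa [RKHS.coe_add] using Measurable.add hf hg
      zero_mem' := by simpa [RKHS.coe_zero] using measurable_zero
      smul_mem' := fun c f hf => by
        simpa [RKHS.coe_smul] using Measurable.const_smul hf c }
  have hspan : Submodule.span ℝ {RKHS.kerFun H x v | (x : Z) (v : ℝ)} ≤ S := by
    rw [Submodule.span_le]
    rintro _ ⟨x, v, rfl⟩
    have e : RKHS.kerFun H x v = v • featureMap H x := by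
      rw [featureMap, ← map_smul, smul_eq_mul, mul_one]
    rw [e]
    refine S.smul_mem v ?_
    have : (featureMap H x : Z → ℝ) = realKernel H x := by
      ext u
      rw [featureMap_apply, realKernel_eq, realKernel_eq, real_inner_comm]
    change Measurable (featureMap H x : Z → ℝ)
    rw [this]
    exact hk x
  have hf : f ∈ (Submodule.span ℝ {RKHS.kerFun H x v | (x : Z) (v : ℝ)}).topologicalClosure := by
    rw [RKHS.kerFun_dense]; trivial
  obtain ⟨F, hF, hlim⟩ := mem_closure_iff_seq_limit.1 hf
  refine measurable_of_tendsto_metrizable (f := fun n => (F n : Z → ℝ)) (fun n => hspan (hF n)) ?_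
  exact tendsto_pi_nhds.2 fun z => ((RKHS.continuous_eval (H := H) z).tendsto f).comp hlim

variable {M : ℝ}

theorem integrable_coe (hk : ∀ x, Measurable (realKernel H (Z := Z) x))
    (hφ : ∀ z : Z, ‖featureMap H z‖ ≤ M) (Q : Measure Z) [IsFiniteMeasure Q] (f : H) :
    Integrable (f : Z → ℝ) Q :=
  Integrable.of_bound (measurable_coe hk f).aestronglyMeasurable (‖f‖ * M)
    (Filter.Eventually.of_forall (abs_apply_le hφ f))

theorem integrable_coe_mul_coe (hk : ∀ x, Measurable (realKernel H (Z := Z) x))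
    (hφ : ∀ z : Z, ‖featureMap H z‖ ≤ M) (Q : Measure Z) [IsFiniteMeasure Q] (f g : H) :
    Integrable (fun z => f z * g z) Q :=
  (integrable_coe hk hφ Q g).bdd_mul (measurable_coe hk f).aestronglyMeasurable
    (Filter.Eventually.of_forall (abs_apply_le hφ f))

variable [TopologicalSpace.SeparableSpace H]

/-- A kernel that is measurable in one argument has a measurable feature map. -/
theorem measurable_featureMap [MeasurableSpace H] [BorelSpace H]
    (hk : ∀ x, Measurable (realKernel H (Z := Z) x)) :
    Measurable (featureMap H : Z → H) := by
  have : SecondCountableTopology H := UniformSpace.secondCountable_of_separable H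
  obtain ⟨s, b, hb⟩ := exists_hilbertBasis ℝ H
  -- Countability of the basis makes `atTop` on its finite subsets countably generated, as needed
  -- for a limit of measurable functions. The coordinates of `featureMap H z` are the values `b i
  -- z`.
  have hs : s.Countable := Orthonormal.countable_set (by rw [← hb]; exact b.orthonormal)
  have := hs.to_subtype
  refine measurable_of_tendsto_metrizable' (Filter.atTop : Filter (Finset s))
    (f := fun F z => ∑ i ∈ F, b.repr (featureMap H z) i • b i) (fun F => ?_)
    (tendsto_pi_nhds.2 fun z => b.hasSum_repr (featureMap H z))
  refine Finset.measurable_fun_sum F fun i _ => Measurable.smul_const ?_ _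
  have : (fun z : Z => b.repr (featureMap H z) i) = (b i : Z → ℝ) := by
    ext z; rw [b.repr_apply_apply, inner_featureMap]
  rw [this]
  exact measurable_coe hk _

theorem integrable_featureMap (hk : ∀ x, Measurable (realKernel H (Z := Z) x))
    (hφ : ∀ z : Z, ‖featureMap H z‖ ≤ M) (P : Measure Z) [IsFiniteMeasure P] :
    Integrable (featureMap H : Z → H) P := by
  borelize H
  have : SecondCountableTopology H := UniformSpace.secondCountable_of_separable H
  exact Integrable.of_bound (measurable_featureMap hk).aestronglyMeasurable M
    (Filter.Eventually.of_forall hφ)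

theorem integrable_rankOne_featureMap (hk : ∀ x, Measurable (realKernel H (Z := Z) x))
    (hφ : ∀ z : Z, ‖featureMap H z‖ ≤ M) (Q : Measure Z) [IsFiniteMeasure Q] :
    Integrable (fun z : Z => InnerProductSpace.rankOne ℝ (featureMap H z) (featureMap H z)) Q := by
  borelize H
  have : SecondCountableTopology H := UniformSpace.secondCountable_of_separable H
  have hc : Continuous fun x : H => InnerProductSpace.rankOne ℝ x x :=
    (InnerProductSpace.rankOne ℝ (E := H) (F := H)).continuous.clm_apply continuous_id
  refine Integrable.of_bound (hc.comp_aestronglyMeasurable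
    (measurable_featureMap hk).aestronglyMeasurable) (M * M) (Filter.Eventually.of_forall fun z => ?_)
  rw [InnerProductSpace.norm_rankOne]
  exact mul_le_mul (hφ z) (hφ z) (norm_nonneg _) ((norm_nonneg _).trans (hφ z))

theorem covarianceOp_isSymmetric (hk : ∀ x, Measurable (realKernel H (Z := Z) x))
    (hφ : ∀ z : Z, ‖featureMap H z‖ ≤ M) (Q : Measure Z) [IsFiniteMeasure Q] :
    (covarianceOp H Q : H →ₗ[ℝ] H).IsSymmetric := by
  intro f g
  have hi := integrable_rankOne_featureMap hk hφ Q
  change ⟪covarianceOp H Q f, g⟫_ℝ = ⟪f, covarianceOp H Q g⟫_ℝ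
  rw [real_inner_comm, inner_covarianceOp Q hi, inner_covarianceOp Q hi]
  simp only [mul_comm]

/-- For an eigenvector `f`, `σ ‖f‖ ^ 2 = ∫ f² dQ`, and `|f z| ≤ ‖f‖ M`. -/
theorem eigenvalue_covarianceOp_mem_Icc (hk : ∀ x, Measurable (realKernel H (Z := Z) x))
    (hφ : ∀ z : Z, ‖featureMap H z‖ ≤ M) (Q : Measure Z) [IsProbabilityMeasure Q] {σ : ℝ}
    (hσ : Module.End.eigenspace (covarianceOp H Q : H →ₗ[ℝ] H) σ ≠ ⊥) : 0 ≤ σ ∧ σ ≤ M ^ 2 := by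
  obtain ⟨f, hf, hf0⟩ := Submodule.exists_mem_ne_zero_of_ne_bot hσ
  have hTf : covarianceOp H Q f = σ • f := Module.End.mem_eigenspace_iff.1 hf
  have hn : 0 < ‖f‖ ^ 2 := by have := norm_pos_iff.2 hf0; positivity
  have h := inner_covarianceOp Q (integrable_rankOne_featureMap hk hφ Q) f f
  rw [hTf, real_inner_smul_right, real_inner_self_eq_norm_sq] at h
  have h0 : 0 ≤ ∫ z, f z * f z ∂Q := integral_nonneg fun z => mul_self_nonneg _
  have h1 : ∫ z, f z * f z ∂Q ≤ ∫ _, ‖f‖ ^ 2 * M ^ 2 ∂Q := by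
    refine integral_mono (integrable_coe_mul_coe hk hφ Q f f) (integrable_const _) fun z => ?_
    change f z * f z ≤ ‖f‖ ^ 2 * M ^ 2
    rw [← sq, ← mul_pow]
    exact sq_le_sq' (abs_le.1 (abs_apply_le hφ f z)).1 (abs_le.1 (abs_apply_le hφ f z)).2
  rw [integral_const, probReal_univ, one_smul] at h1
  exact ⟨by nlinarith, by nlinarith⟩

/-- Tested against `f`, both sides equal `∫ f (dP/dQ - 1) dQ`. -/
theorem meanEmbedding_sub_eq_covarianceOp (hk : ∀ x, Measurable (realKernel H (Z := Z) x))
    (hφ : ∀ z : Z, ‖featureMap H z‖ ≤ M) {P Q : Measure Z} [IsProbabilityMeasure P]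
    [IsProbabilityMeasure Q] (hPQ : P ≪ Q) {h : H}
    (hh : ∀ᵐ z ∂Q, (P.rnDeriv Q z).toReal = 1 + h z) :
    meanEmbedding H P - meanEmbedding H Q = covarianceOp H Q h := by
  refine ext_inner_left ℝ fun f => ?_
  rw [inner_sub_right, inner_meanEmbedding P (integrable_featureMap hk hφ P),
    inner_meanEmbedding Q (integrable_featureMap hk hφ Q),
    inner_covarianceOp Q (integrable_rankOne_featureMap hk hφ Q), ← integral_toReal_rnDeriv_mul hPQ]
  have : ∫ z, (P.rnDeriv Q z).toReal * f z ∂Q = ∫ z, (f z + f z * h z) ∂Q :=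
    integral_congr_ae (hh.mono fun z hz => by dsimp only; rw [hz]; ring)
  rw [this, integral_add (integrable_coe hk hφ Q f) (integrable_coe_mul_coe hk hφ Q f h)]
  ring

/-- The quadratic form of the operator at `g - h` is `∫ (g - h)² dQ`, which must vanish. -/
theorem ae_eq_of_covarianceOp_eq (hk : ∀ x, Measurable (realKernel H (Z := Z) x))
    (hφ : ∀ z : Z, ‖featureMap H z‖ ≤ M) {Q : Measure Z} [IsProbabilityMeasure Q] {g h : H}
    (hgh : covarianceOp H Q g = covarianceOp H Q h) : ∀ᵐ z ∂Q, g z = h z := by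
  have h0 := inner_covarianceOp Q (integrable_rankOne_featureMap hk hφ Q) (g - h) (g - h)
  rw [map_sub, hgh, sub_self, inner_zero_right] at h0
  have := (integral_eq_zero_iff_of_nonneg (fun z => mul_self_nonneg ((g - h) z))
    (integrable_coe_mul_coe hk hφ Q (g - h) (g - h))).1 h0.symm
  filter_upwards [this] with z hz
  have hz' := mul_self_eq_zero.1 hz
  rw [RKHS.coe_sub, Pi.sub_apply] at hz'
  linarith

theorem integral_weighted_featureMap (hk : ∀ x, Measurable (realKernel H (Z := Z) x))
    (hφ : ∀ z : Z, ‖featureMap H z‖ ≤ M) (Q : Measure Z) [IsProbabilityMeasure Q] (v : H) :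
    ∫ z, (1 + v z) • featureMap H z ∂Q = meanEmbedding H Q + covarianceOp H Q v := by
  have hi := integrable_rankOne_featureMap hk hφ Q
  have e : ∀ z : Z, (1 + v z) • featureMap H z =
      featureMap H z + InnerProductSpace.rankOne ℝ (featureMap H z) (featureMap H z) v := fun z => by
    rw [InnerProductSpace.rankOne_apply, real_inner_comm, inner_featureMap, add_smul, one_smul]
  simp only [e]
  rw [integral_add (integrable_featureMap hk hφ Q) (hi.apply_continuousLinearMap v),
    meanEmbedding, covarianceOp, ContinuousLinearMap.integral_apply hi]

end KernelMeasurability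

/-! ### Deterministic error bound, choice of `lam`, and the probability estimate -/

section Estimate

open scoped InnerProductSpace

variable {Z : Type*} {H : Type*} [NormedAddCommGroup H]
  [InnerProductSpace ℝ H] [CompleteSpace H] [RKHS ℝ H Z ℝ]

/-- The regularized empirical covariance operator is bounded below by `lam`. -/
theorem mul_norm_le_norm_empirical_covariance_add (lam : ℝ) {n : ℕ} (y : Fin n → Z) (e : H) :
    lam * ‖e‖ ≤ ‖(n : ℝ)⁻¹ • ∑ j, e (y j) • featureMap H (y j) + lam • e‖ := by
  rcases eq_or_ne e 0 with rfl | he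
  · simp
  have hpos : 0 < ‖e‖ := norm_pos_iff.2 he
  set a := (n : ℝ)⁻¹ • ∑ j, e (y j) • featureMap H (y j) + lam • e with ha
  have h1 : lam * ‖e‖ ^ 2 ≤ ⟪e, a⟫_ℝ := by
    rw [ha, inner_add_right, real_inner_smul_right, real_inner_smul_right, inner_sum,
      real_inner_self_eq_norm_sq]
    have : 0 ≤ ∑ j, ⟪e, e (y j) • featureMap H (y j)⟫_ℝ := Finset.sum_nonneg fun j _ => by
      rw [real_inner_smul_right, inner_featureMap]; exact mul_self_nonneg _
    have : 0 ≤ (n : ℝ)⁻¹ * ∑ j, ⟪e, e (y j) • featureMap H (y j)⟫_ℝ := by positivity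
    linarith
  have h2 := h1.trans (real_inner_le_norm e a)
  refine le_of_mul_le_mul_left ?_ hpos
  linarith

/-- Applying the regularized empirical operator to `h - v` leaves exactly the two deviations bounded
by `a` and `b`; inverting it costs `1 / lam`. In use, `p` is `μ_P`. -/
theorem rkhsNorm_ratioEstimator_sub_le {lam : ℝ} (hl : 0 < lam) {m n : ℕ} (hn : 0 < n)
    (x : Fin m → Z) (y : Fin n → Z) {p v g : H} {a b c : ℝ}
    (hx : ‖(m : ℝ)⁻¹ • ∑ i, featureMap H (x i) - p‖ ≤ a)
    (hy : ‖(n : ℝ)⁻¹ • ∑ j, (1 + v (y j)) • featureMap H (y j) - (p - lam • v)‖ ≤ b)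
    (hvg : ‖v - g‖ ≤ c) :
    rkhsNorm H (fun u => ratioEstimator (realKernel H) lam x y u - (1 + g u)) ≤
      ENNReal.ofReal ((a + b) / lam + c) := by
  obtain ⟨h, hu, heq⟩ := ratioEstimator_eq (H := H) hl hn x y
  have hid : (n : ℝ)⁻¹ • ∑ j, (h - v) (y j) • featureMap H (y j) + lam • (h - v) =
      ((m : ℝ)⁻¹ • ∑ i, featureMap H (x i) - p) -
        ((n : ℝ)⁻¹ • ∑ j, (1 + v (y j)) • featureMap H (y j) - (p - lam • v)) := by
    simp only [RKHS.coe_sub, Pi.sub_apply, sub_smul, add_smul, one_smul, Finset.sum_sub_distrib,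
      Finset.sum_add_distrib, smul_sub, smul_add]
    have := eq_sub_of_add_eq heq
    rw [this]
    abel
  have he : ‖h - v‖ ≤ (a + b) / lam := by
    rw [le_div_iff₀' hl]
    refine (mul_norm_le_norm_empirical_covariance_add lam y (h - v)).trans ?_
    rw [hid]
    exact (norm_sub_le _ _).trans (add_le_add hx hy)
  refine (iInf₂_le (h - g) ?_).trans ?_
  · ext u
    rw [hu, RKHS.coe_sub, Pi.sub_apply]
    ring
  · rw [← ofReal_norm]
    refine ENNReal.ofReal_le_ofReal ?_
    rw [← sub_add_sub_cancel h v g]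
    exact (norm_add_le _ _).trans (add_le_add he hvg)

/-- The stochastic error `√(l / N) / lam` and the bias `lam ^ (θ - 1)` for the choice
`lam = N ^ (-1 / (2 (θ + 1)))`. -/
theorem rate_le {N l θ D R : ℝ} (hN : 1 ≤ N) (hl : 1 ≤ l) (hθ : 1 < θ) (hD : 0 ≤ D) (hR : 0 ≤ R) :
    D * √(l / N) / N ^ (-(1 / (2 * (θ + 1)))) + (N ^ (-(1 / (2 * (θ + 1))))) ^ (θ - 1) * R ≤
      (D + R) * N ^ (-((θ - 1) / (2 * (θ + 1)))) * √l := by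
  have hN0 : 0 < N := by linarith
  have hθ' : 0 < θ + 1 := by linarith
  have h1 : √(l / N) / N ^ (-(1 / (2 * (θ + 1)))) ≤ N ^ (-((θ - 1) / (2 * (θ + 1)))) * √l := by
    rw [Real.sqrt_div (by linarith), Real.sqrt_eq_rpow N, div_div, ← Real.rpow_add hN0,
      div_eq_mul_inv, ← Real.rpow_neg hN0.le, mul_comm]
    gcongr
    -- The stochastic term is of order `N ^ (-θ / (2 (θ + 1)))`, smaller than the bias by a factor
    -- `N ^ (-1 / (2 (θ + 1)))`.
    rw [← sub_nonneg]
    have : 1 / 2 + -(1 / (2 * (θ + 1))) - (θ - 1) / (2 * (θ + 1)) = 1 / (2 * (θ + 1)) := by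
      field_simp; ring
    rw [this]; positivity
  have h2 : (N ^ (-(1 / (2 * (θ + 1))))) ^ (θ - 1) ≤ N ^ (-((θ - 1) / (2 * (θ + 1)))) * √l := by
    rw [← Real.rpow_mul hN0.le]
    have e : -(1 / (2 * (θ + 1))) * (θ - 1) = -((θ - 1) / (2 * (θ + 1))) := by ring
    rw [e]
    exact le_mul_of_one_le_right (by positivity) (Real.one_le_sqrt.2 hl)
  calc _ = D * (√(l / N) / N ^ (-(1 / (2 * (θ + 1))))) +
        R * (N ^ (-(1 / (2 * (θ + 1))))) ^ (θ - 1) := by ring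
    _ ≤ D * (N ^ (-((θ - 1) / (2 * (θ + 1)))) * √l) +
        R * (N ^ (-((θ - 1) / (2 * (θ + 1)))) * √l) := by gcongr
    _ = _ := by ring

end Estimate

/-- With probability at least `1 - η`, the estimator is within the sum of its stochastic error and
the bias bound `c` of any function `1 + g` with `‖v - g‖ ≤ c`, where `v` is the population
regularized solution. -/
theorem ratioEstimator_concentration {Z : Type*} [MeasurableSpace Z]
    {H : Type*} [NormedAddCommGroup H] [InnerProductSpace ℝ H] [CompleteSpace H]
    [TopologicalSpace.SeparableSpace H] [RKHS ℝ H Z ℝ]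
    {P Q : Measure Z} [IsProbabilityMeasure P] [IsProbabilityMeasure Q]
    (hk : ∀ x, Measurable (realKernel H (Z := Z) x)) {M : ℝ} (hM : 1 ≤ M)
    (hφ : ∀ z : Z, ‖featureMap H z‖ ≤ M) {Ω : Type*} [MeasurableSpace Ω] {Pr : Measure Ω}
    [IsProbabilityMeasure Pr] {m n : ℕ} {X : Fin m → Ω → Z} {Y : Fin n → Ω → Z} {η : ℝ}
    (hm : 0 < m) (hn : 0 < n) (hX : ∀ i, Measurable (X i)) (hXP : ∀ i, Pr.map (X i) = P)
    (hXi : iIndepFun X Pr) (hY : ∀ j, Measurable (Y j)) (hYQ : ∀ j, Pr.map (Y j) = Q)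
    (hYi : iIndepFun Y Pr) (hη : 0 < η) (hη' : η < Real.exp (-1)) {lam c D : ℝ} (hl : 0 < lam)
    {v g : H} (hv : covarianceOp H Q v + lam • v = meanEmbedding H P - meanEmbedding H Q)
    (hvD : ‖v‖ ≤ D) (hvg : ‖v - g‖ ≤ c) :
    ENNReal.ofReal (1 - η) ≤
      Pr {ω | rkhsNorm H (fun u => ratioEstimator (realKernel H) lam
          (fun i => X i ω) (fun j => Y j ω) u - (1 + g u)) ≤
        ENNReal.ofReal ((5 * M + 5 * ((1 + D * M) * M)) *
          √(Real.log (1 / η) / ((min m n : ℕ) : ℝ)) / lam + c)} := by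
  borelize H
  have : SecondCountableTopology H := UniformSpace.secondCountable_of_separable H
  have hM0 : 0 < M := by linarith
  have hD : 0 ≤ D := (norm_nonneg v).trans hvD
  have hφm := measurable_featureMap hk
  have hwm : Measurable fun z : Z => (1 + v z) • featureMap H z :=
    ((measurable_coe hk v).const_add 1).smul hφm
  have hwb : ∀ z : Z, ‖(1 + v z) • featureMap H z‖ ≤ (1 + D * M) * M := fun z => by
    rw [norm_smul]
    have h1 : ‖1 + v z‖ ≤ 1 + D * M := by
      refine (norm_add_le _ _).trans ?_
      rw [norm_one]
      have := (abs_apply_le hφ v z).trans (mul_le_mul_of_nonneg_right hvD hM0.le)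
      rw [Real.norm_eq_abs]
      linarith
    exact mul_le_mul h1 (hφ z) (norm_nonneg _) (by positivity)
  have hL : 0 ≤ Real.log (1 / η) := by
    rw [one_div]
    exact Real.log_nonneg ((one_le_inv₀ hη).2 (hη'.le.trans (Real.exp_le_one_iff.2 (by norm_num))))
  have hN : (0 : ℝ) < ((min m n : ℕ) : ℝ) := by exact_mod_cast lt_min hm hn
  have hb1 := measure_lt_norm_mean_sub_le (Pr := Pr) hm (ξ := fun i ω => featureMap H (X i ω))
    (fun i => hφm.comp (hX i)) (hXi.comp (fun _ => featureMap H) fun _ => hφm) hM0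
    (fun i ω => hφ _) (μ := meanEmbedding H P)
    (fun i => by
      rw [meanEmbedding, ← hXP i, integral_map (hX i).aemeasurable hφm.aestronglyMeasurable])
    hη hη'
  have hb2 := measure_lt_norm_mean_sub_le (Pr := Pr) hn
    (ξ := fun j ω => (1 + v (Y j ω)) • featureMap H (Y j ω))
    (fun j => hwm.comp (hY j)) (hYi.comp (fun _ z => (1 + v z) • featureMap H z) fun _ => hwm)
    (B := (1 + D * M) * M) (by positivity) (fun j ω => hwb _)
    (μ := meanEmbedding H P - lam • v)
    -- The expectation is `μ_Q + T v`, which equals `μ_P - lam v` by the equation defining `v`.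
    (fun j => by
      have h := integral_weighted_featureMap hk hφ Q v
      rw [← hYQ j, integral_map (hY j).aemeasurable hwm.aestronglyMeasurable, hYQ j] at h
      rw [h, eq_sub_iff_add_eq, add_assoc, hv]
      abel)
    hη hη'
  set bad1 := {ω | 5 * M * √(Real.log (1 / η) / m) <
    ‖(m : ℝ)⁻¹ • ∑ i, featureMap H (X i ω) - meanEmbedding H P‖}
  set bad2 := {ω | 5 * ((1 + D * M) * M) * √(Real.log (1 / η) / n) <
    ‖(n : ℝ)⁻¹ • ∑ j, (1 + v (Y j ω)) • featureMap H (Y j ω) - (meanEmbedding H P - lam • v)‖}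
  set good := {ω | rkhsNorm H (fun u => ratioEstimator (realKernel H) lam
    (fun i => X i ω) (fun j => Y j ω) u - (1 + g u)) ≤
      ENNReal.ofReal ((5 * M + 5 * ((1 + D * M) * M)) *
        √(Real.log (1 / η) / ((min m n : ℕ) : ℝ)) / lam + c)}
  -- A covering and a union bound: subadditivity suffices, so the good event need not be shown
  -- measurable and the two samples need not be jointly independent.
  have hcover : Set.univ ⊆ good ∪ (bad1 ∪ bad2) := by
    intro ω _
    by_contra hω
    simp only [Set.mem_union, not_or] at hω
    obtain ⟨hg, h1, h2⟩ := hω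
    refine hg ?_
    simp only [bad1, bad2, Set.mem_ofPred_eq, not_lt] at h1 h2
    refine (rkhsNorm_ratioEstimator_sub_le hl hn _ _ h1 h2 hvg).trans
      (ENNReal.ofReal_le_ofReal ?_)
    rw [add_mul (5 * M)]
    gcongr
    · exact min_le_left m n
    · exact min_le_right m n
  have hprob : 1 ≤ Pr good + ENNReal.ofReal η := by
    calc (1 : ℝ≥0∞) = Pr Set.univ := measure_univ.symm
      _ ≤ Pr (good ∪ (bad1 ∪ bad2)) := measure_mono hcover
      _ ≤ Pr good + (Pr bad1 + Pr bad2) :=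
          (measure_union_le _ _).trans (by gcongr; exact measure_union_le _ _)
      _ ≤ Pr good + (ENNReal.ofReal (η / 2) + ENNReal.ofReal (η / 2)) := by gcongr
      _ = Pr good + ENNReal.ofReal η := by
          rw [← ENNReal.ofReal_add (by positivity) (by positivity), add_halves]
  rw [ENNReal.ofReal_sub _ hη.le, ENNReal.ofReal_one]
  exact tsub_le_iff_right.2 hprob

end WitnessConvergence

/-! ### The convergence rate -/

theorem lemma1 (K R : ℝ) :
    ∃ C₁ : ℝ, 0 < C₁ ∧
      ∀ (Z : Type u) [MeasurableSpace Z]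
        (H : Type v) [NormedAddCommGroup H] [InnerProductSpace ℝ H] [CompleteSpace H]
        [TopologicalSpace.SeparableSpace H] [RKHS ℝ H Z ℝ]
        (P Q : Measure Z) [IsProbabilityMeasure P] [IsProbabilityMeasure Q] (θ : ℝ) (w : H),
        (∀ x, Measurable (WitnessConvergence.realKernel H (Z := Z) x)) →
        (∀ x y : Z, |WitnessConvergence.realKernel H x y| ≤ K) →
        P ≪ Q →
        (∃ h : H, ∀ᵐ z ∂Q, (P.rnDeriv Q z).toReal = 1 + h z) →
        1 < θ → θ ≤ 2 →
        WitnessConvergence.meanEmbedding H P - WitnessConvergence.meanEmbedding H Q =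
          WitnessConvergence.fractionalPower (WitnessConvergence.covarianceOp H Q) θ w →
        ‖w‖ ≤ R →
        ∃ r : Z → ℝ, (∀ᵐ z ∂Q, r z = (P.rnDeriv Q z).toReal) ∧
          ∀ (Ω : Type t) [MeasurableSpace Ω] (Pr : Measure Ω) [IsProbabilityMeasure Pr]
            (m n : ℕ) (X : Fin m → Ω → Z) (Y : Fin n → Ω → Z) (η : ℝ),
            0 < m → 0 < n →
            (∀ i, Measurable (X i)) → (∀ i, Pr.map (X i) = P) → iIndepFun X Pr →
            (∀ j, Measurable (Y j)) → (∀ j, Pr.map (Y j) = Q) → iIndepFun Y Pr →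
            0 < η → η < Real.exp (-1) →
            ENNReal.ofReal (1 - η) ≤
              Pr {ω | WitnessConvergence.rkhsNorm H (fun u =>
                    WitnessConvergence.ratioEstimator (WitnessConvergence.realKernel H)
                      (((min m n : ℕ) : ℝ) ^ (-(1 / (2 * (θ + 1)))))
                      (fun i => X i ω) (fun j => Y j ω) u - r u)
                  ≤ ENNReal.ofReal (C₁ * ((min m n : ℕ) : ℝ) ^ (-((θ - 1) / (2 * (θ + 1))))
                      * Real.sqrt (Real.log (1 / η)))} := by
  set M : ℝ := max 1 K with hMdef
  have hM : 1 ≤ M := le_max_left 1 K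
  -- The terms come from Hoeffding's inequality for `k(X, ·)`, of norm at most `M`, and for `(1 +
  -- v(Y)) k(Y, ·)`, where `‖v‖ ≤ M ^ 2 |R|`. Using `|R|` keeps the constant positive for every `R`.
  set D : ℝ := 5 * M + 5 * ((1 + M ^ 2 * |R| * M) * M)
  have hD : 0 < D := by positivity
  refine ⟨D + |R|, by positivity, ?_⟩
  intro Z _ H _ _ _ _ _ P Q _ _ θ w hk hK hPQ hrn hθ hθ' hsrc hw
  have hφ : ∀ z : Z, ‖WitnessConvergence.featureMap H z‖ ≤ M :=
    WitnessConvergence.norm_featureMap_le hK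
  have hwR : ‖w‖ ≤ |R| := hw.trans (le_abs_self R)
  obtain ⟨g, hg, hreg⟩ := WitnessConvergence.exists_tikhonov_of_source
    (WitnessConvergence.covarianceOp_isSymmetric hk hφ Q) (one_le_pow₀ hM : 1 ≤ M ^ 2)
    (fun σ hσ => WitnessConvergence.eigenvalue_covarianceOp_mem_Icc hk hφ Q hσ) hθ hθ' w
  obtain ⟨h, hh⟩ := hrn
  -- The version must be `1 + g`, not `1 + h`: they may differ off a `Q`-full set, and it is `g`
  -- that the regularized solutions approach in norm.
  refine ⟨fun z => 1 + g z, ?_, ?_⟩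
  · have hgh := WitnessConvergence.ae_eq_of_covarianceOp_eq hk hφ (g := g) (h := h)
      (hg.trans (hsrc.symm.trans
        (WitnessConvergence.meanEmbedding_sub_eq_covarianceOp hk hφ hPQ hh)))
    filter_upwards [hgh, hh] with z h1 h2
    rw [h2, h1]
  · intro Ω _ Pr _ m n X Y η hm hn hX hXP hXi hY hYQ hYi hη hη'
    have hN : (1 : ℝ) ≤ ((min m n : ℕ) : ℝ) := by exact_mod_cast le_min hm hn
    have hl : 1 ≤ Real.log (1 / η) := by
      rw [one_div, Real.log_inv]
      have := Real.log_lt_log hη hη'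
      rw [Real.log_exp] at this
      linarith
    have hlam : 0 < ((min m n : ℕ) : ℝ) ^ (-(1 / (2 * (θ + 1)))) :=
      Real.rpow_pos_of_pos (by linarith) _
    obtain ⟨v, hv, hvM, hvg⟩ := hreg _ hlam
    refine (WitnessConvergence.ratioEstimator_concentration hk hM hφ hm hn hX hXP hXi hY hYQ hYi hη
      hη' hlam (hv.trans hsrc.symm) (hvM.trans (mul_le_mul_of_nonneg_left hwR (by positivity)))
      (hvg.trans (mul_le_mul_of_nonneg_left hwR (by positivity)))).trans
      (measure_mono fun ω hω => ?_)
    rw [Set.mem_ofPred_eq] at hω ⊢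
    exact hω.trans (ENNReal.ofReal_le_ofReal
      (WitnessConvergence.rate_le hN hl hθ hD.le (abs_nonneg R)))
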